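/- Let $G$ be a finite group. Call $G$ real if every $g\in G$ is conjugate in $G$ to $g^{-1}$. Call $G$ doubly real if for all $x,y\in G$ there is $g\in G$ with $gxg^{-1}=x^{-1}$ and $gyg^{-1}=y^{-1}$; equivalently, every simultaneous conjugacy class in $G^2$ is closed under componentwise inversion. Say that $G$ has multiplicity-free tensor products if for any two irreducible complex representations $U$ and $V$ of $G$, the representation $U\otimes V$ (with the diagonal action of $G$) is a direct sum of pairwise non-isomorphic irreducible representations. Then $G$ is doubly real if and only if $G$ is real and has multiplicity-free tensor products. -/

import Mathlib

open scoped TensorProduct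

namespace DoublyReal

section Reality

variable {G : Type*} [Group G]

/-- The simultaneous conjugacy class of a `d`-tuple `x` of elements of `G`. -/
def simConjClass {d : ℕ} (x : Fin d → G) : Set (Fin d → G) :=
  {y | ∃ g : G, ∀ i, y i = g * x i * g⁻¹}

/-- A set of `d`-tuples is real if it is closed under componentwise inversion. -/
def IsRealClass {d : ℕ} (C : Set (Fin d → G)) : Prop :=
  ∀ y ∈ C, (fun i => (y i)⁻¹) ∈ C

variable (G)

/-- `G` is `d`-real if every simultaneous conjugacy class of `d`-tuples is real. -/
def IsDReal (d : ℕ) : Prop :=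
  ∀ x : Fin d → G, IsRealClass (simConjClass x)

/-- `G` is doubly real if it is `2`-real. -/
def IsDoublyReal : Prop := IsDReal G 2

/-- `G` is real if every element is conjugate to its inverse. -/
def IsReal : Prop := ∀ g : G, IsConj g g⁻¹

end Reality

/-- A complex representation has a multiplicity-free decomposition into irreducibles if it is the
internal direct sum of finitely many irreducible subrepresentations, no two of which (at distinct
indices) are isomorphic. -/
def IsMultiplicityFree {G V : Type*} [Group G] [AddCommGroup V] [Module ℂ V]
    (ρ : Representation ℂ G V) : Prop :=
  ∃ (n : ℕ) (W : Fin n → Subrepresentation ρ),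
    DirectSum.IsInternal (fun i => (W i).toSubmodule) ∧
    (∀ i, (W i).toRepresentation.IsIrreducible) ∧
    ∀ i j, i ≠ j →
      IsEmpty (Representation.Equiv (W i).toRepresentation (W j).toRepresentation)

/-- `G` has multiplicity-free tensor products if `U ⊗ V` is multiplicity-free for all irreducible
complex representations `U` and `V` of `G`. For a finite group every irreducible representation is
finite-dimensional, hence isomorphic to one on a space in `Type`. -/
def HasMultiplicityFreeTensorProducts (G : Type*) [Group G] : Prop :=
  ∀ (U V : Type) [AddCommGroup U] [Module ℂ U] [AddCommGroup V] [Module ℂ V]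
    (ρ : Representation ℂ G U) (σ : Representation ℂ G V),
    ρ.IsIrreducible → σ.IsIrreducible → IsMultiplicityFree (ρ.tprod σ)

end DoublyReal

/-! For irreducible U and V, Burnside's theorem says that the operators of G × G span End(U ⊗ V), so
averaging over the diagonal shows that the sums `conjSum` over diagonal conjugates span the
commutant of G (`mem_span_conjSum`). Both directions hinge on whether p and p⁻¹ give the same sum.

If G is doubly real they do. Inversion reverses products, so Gelfand's trick makes the commutant
commutative (`conjSum_mul_comm`), which rules out repeated summands.

Conversely, if U ⊗ V is multiplicity-free, each sum is scalar on every summand. Traces against G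
determine the scalars, and reality makes them agree for p and p⁻¹
(`conjSum_inv_eq_of_isMultiplicityFree`). Adding the resulting character identities over all pairs
of constituents of the regular representation counts the g that invert x and y simultaneously. -/

/-! ### Complete reducibility and Burnside's theorem -/

section Decomposition

open scoped MonoidAlgebra

variable {G V : Type*} [Group G] [AddCommGroup V] [Module ℂ V]

/-- Subrepresentations of a subrepresentation `W` are the subrepresentations contained in `W`. -/
def Subrepresentation.orderIsoIic {ρ : Representation ℂ G V} (W : Subrepresentation ρ) :
    Subrepresentation W.toRepresentation ≃o Set.Iic W where
  toFun T := ⟨⟨T.toSubmodule.map W.toSubmodule.subtype, by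
      rintro g _ ⟨v, hv, rfl⟩
      exact ⟨W.toRepresentation g v, T.apply_mem_toSubmodule g hv, rfl⟩⟩, by
      rintro _ ⟨v, hv, rfl⟩
      exact v.2⟩
  invFun T := ⟨T.1.toSubmodule.comap W.toSubmodule.subtype, fun g _ hv =>
      T.1.apply_mem_toSubmodule g hv⟩
  left_inv T := by
    apply Subrepresentation.toSubmodule_injective
    exact Submodule.comap_map_eq_of_injective (Submodule.injective_subtype _) _
  right_inv T := by
    apply Subtype.ext
    apply Subrepresentation.toSubmodule_injective
    exact (Submodule.map_comap_subtype _ _).trans (inf_eq_right.2 T.2)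
  map_rel_iff' {S T} := by
    change S.toSubmodule.map _ ≤ T.toSubmodule.map _ ↔ S.toSubmodule ≤ T.toSubmodule
    exact Submodule.map_le_map_iff_of_injective (Submodule.injective_subtype _) _ _

theorem Subrepresentation.isIrreducible_toRepresentation_iff {ρ : Representation ℂ G V}
    (W : Subrepresentation ρ) : W.toRepresentation.IsIrreducible ↔ IsAtom W := by
  rw [← Set.isSimpleOrder_Iic_iff_isAtom]
  exact W.orderIsoIic.isSimpleOrder_iff

theorem Representation.exists_isInternal_irreducible [Finite G] [FiniteDimensional ℂ V]
    (ρ : Representation ℂ G V) :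
    ∃ (n : ℕ) (W : Fin n → Subrepresentation ρ),
      DirectSum.IsInternal (fun i => (W i).toSubmodule) ∧
      ∀ i, (W i).toRepresentation.IsIrreducible := by
  classical
  have : Module.Finite ℂ ρ.asModule := inferInstanceAs (Module.Finite ℂ V)
  have : Module.Finite ℂ[G] ρ.asModule := Module.Finite.of_restrictScalars_finite ℂ _ _
  obtain ⟨s, ind, hsup, simple⟩ :=
    IsSemisimpleModule.exists_sSupIndep_sSup_simples_eq_top ℂ[G] ρ.asModule
  have : Finite s := WellFoundedGT.finite_of_iSupIndep ((sSupIndep_iff _).mp ind)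
    fun S ↦ (S.1.nontrivial_iff_ne_bot).mp <|
      have := simple S.1 S.2; IsSimpleModule.nontrivial ℂ[G] S
  let e := (Finite.equivFin s).symm
  refine ⟨_, fun i => Subrepresentation.ofSubmodule' (e i).1, ?_, fun i => ?_⟩
  · have h : DirectSum.IsInternal (fun i => (e i).1) := by
      apply DirectSum.isInternal_submodule_of_iSupIndep_of_iSup_eq_top
      · exact ((sSupIndep_iff _).mp ind).comp e.injective
      · rw [e.iSup_comp (g := fun i : s => i.1), ← sSup_eq_iSup', hsup]
    exact h
  · rw [Subrepresentation.isIrreducible_toRepresentation_iff]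
    have h := isSimpleModule_iff_isAtom.1 (simple _ (e i).2)
    exact (Subrepresentation.subrepresentationSubmoduleOrderIso (ρ := ρ)).symm.isAtom_iff _ |>.2 h

theorem Representation.IsIrreducible.finiteDimensional [Finite G] {ρ : Representation ℂ G V}
    (h : ρ.IsIrreducible) : FiniteDimensional ℂ V := by
  have := (Representation.irreducible_iff_isSimpleModule_asModule ρ).1 h
  have : Module.Finite ℂ[G] ρ.asModule := inferInstance
  have : Module.Finite ℂ ℂ[G] := inferInstance
  exact Module.Finite.trans (R := ℂ) ℂ[G] ρ.asModule

/-- **Burnside's theorem**: the operators of an irreducible representation span all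
endomorphisms. -/
theorem Representation.IsIrreducible.span_range_eq_top [Finite G] {ρ : Representation ℂ G V}
    (h : ρ.IsIrreducible) : Submodule.span ℂ (Set.range ρ) = ⊤ := by
  have := h.finiteDimensional
  have : Module.Finite ℂ ρ.asModule := inferInstanceAs (Module.Finite ℂ V)
  have := (Representation.irreducible_iff_isSimpleModule_asModule ρ).1 h
  have : Module.Finite (Module.End ℂ[G] ρ.asModule) ρ.asModule :=
    Module.Finite.of_restrictScalars_finite ℂ _ _
  -- Jacobson density; by Schur the endomorphism ring is ℂ, so every ℂ-linear map qualifies.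
  have hsurj := Module.Finite.toModuleEnd_moduleEnd_surjective (R := ℂ[G]) (M := ρ.asModule)
  have hS := IsSimpleModule.algebraMap_end_bijective_of_isAlgClosed (A := ℂ[G])
    (V := ρ.asModule) ℂ
  rw [eq_top_iff]
  rintro f -
  obtain ⟨r, hr⟩ := hsurj
    { toFun := f
      map_add' := f.map_add
      map_smul' := fun m x => by
        obtain ⟨c, rfl⟩ := hS.2 m
        exact f.map_smul c x }
  have hf : f = ρ.asAlgebraHom r := by
    ext v
    exact (LinearMap.congr_fun hr v).symm
  rw [hf]
  clear hf hr
  induction r using MonoidAlgebra.induction_linear with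
  | zero => simp
  | add x y hx hy =>
    rw [map_add]
    exact Submodule.add_mem _ hx hy
  | single g a =>
    rw [Representation.asAlgebraHom_single]
    exact Submodule.smul_mem _ _ (Submodule.subset_span ⟨g, rfl⟩)

end Decomposition

/-! ### Schur's lemma and traces on a direct sum -/

section InternalSum

variable {G V ι : Type*} [Group G] [AddCommGroup V] [Module ℂ V] {ρ : Representation ℂ G V}

/-- The inclusion of a subrepresentation, as an intertwining map. -/
def Subrepresentation.incl (W : Subrepresentation ρ) :
    Representation.IntertwiningMap W.toRepresentation ρ where
  toLinearMap := W.toSubmodule.subtype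
  isIntertwining' _ := rfl

variable [DecidableEq ι] {W : ι → Subrepresentation ρ}

/-- The projection onto a summand of an internal direct sum of subrepresentations. -/
noncomputable def Subrepresentation.proj
    (h : DirectSum.IsInternal (fun i => (W i).toSubmodule)) (i : ι) :
    Representation.IntertwiningMap ρ (W i).toRepresentation where
  toLinearMap := DirectSum.component ℂ ι (fun i => (W i).toSubmodule) i ∘ₗ
    (LinearEquiv.ofBijective (DirectSum.coeLinearMap fun i => (W i).toSubmodule) h).symm.toLinearMap
  isIntertwining' g := by
    let e := LinearEquiv.ofBijective (DirectSum.coeLinearMap fun i => (W i).toSubmodule) h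
    refine LinearMap.ext fun v => ?_
    obtain ⟨x, rfl⟩ := e.surjective v
    change (e.symm (ρ g (e x))) i = (W i).toRepresentation g ((e.symm (e x)) i)
    rw [e.symm_apply_apply]
    induction x using DirectSum.induction_on with
    | zero => simp
    | add x y hx hy => simp [hx, hy]
    | of j w =>
      have h1 : ∀ w : (W j).toSubmodule, e (DirectSum.of (fun i => (W i).toSubmodule) j w) = w :=
        fun w => DirectSum.coeLinearMap_of _ _ _
      have h2 : ρ g (e (DirectSum.of (fun i => (W i).toSubmodule) j w)) =
          e (DirectSum.of (fun i => (W i).toSubmodule) j ((W j).toRepresentation g w)) := by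
        rw [h1, h1]; rfl
      rw [h2, e.symm_apply_apply]
      by_cases hij : j = i
      · subst hij
        simp
      · rw [DirectSum.of_eq_of_ne _ _ _ (Ne.symm hij), DirectSum.of_eq_of_ne _ _ _ (Ne.symm hij),
          map_zero]

theorem Subrepresentation.proj_coe (h : DirectSum.IsInternal (fun i => (W i).toSubmodule)) (i : ι)
    (w : (W i).toSubmodule) : Subrepresentation.proj h i (w : V) = w :=
  h.ofBijective_coeLinearMap_same w

theorem Subrepresentation.proj_coe_of_ne (h : DirectSum.IsInternal (fun i => (W i).toSubmodule))
    {i j : ι} (hij : i ≠ j) (w : (W i).toSubmodule) : Subrepresentation.proj h j (w : V) = 0 :=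
  h.ofBijective_coeLinearMap_of_ne hij w

theorem Subrepresentation.sum_proj [Fintype ι]
    (h : DirectSum.IsInternal (fun i => (W i).toSubmodule)) (v : V) :
    ∑ i, (Subrepresentation.proj h i v : V) = v := by
  classical
  let e := LinearEquiv.ofBijective (DirectSum.coeLinearMap fun i => (W i).toSubmodule) h
  have := e.apply_symm_apply v
  conv_rhs => rw [← this]
  change _ = DirectSum.coeLinearMap (fun i => (W i).toSubmodule) (e.symm v)
  rw [DirectSum.coeLinearMap_eq_dfinsuppSum, DFinsupp.sum_eq_sum_fintype _ (by simp)]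
  rfl

/-- **Schur's lemma**: an endomorphism acts by a scalar on each summand of a multiplicity-free
decomposition. -/
theorem Subrepresentation.exists_forall_apply_eq_smul [Fintype ι] [FiniteDimensional ℂ V]
    (h : DirectSum.IsInternal (fun i => (W i).toSubmodule))
    (hirr : ∀ i, (W i).toRepresentation.IsIrreducible)
    (hne : ∀ i j, i ≠ j →
      IsEmpty (Representation.Equiv (W i).toRepresentation (W j).toRepresentation))
    (s : Representation.IntertwiningMap ρ ρ) :
    ∃ c : ι → ℂ, ∀ i, ∀ w : (W i).toSubmodule, s w = c i • (w : V) := by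
  have hdiag : ∀ i, ∃ c : ℂ, ∀ w : (W i).toSubmodule,
      Subrepresentation.proj h i (s (w : V)) = c • w := by
    intro i
    have := hirr i
    let f := (Subrepresentation.proj h i).comp (s.comp (W i).incl)
    obtain ⟨c, hc⟩ :=
      (Representation.IsIrreducible.algebraMap_intertwiningMap_bijective_of_isAlgClosed
        (ρ := (W i).toRepresentation) (k := ℂ)).2 f
    exact ⟨c, fun w => (DFunLike.congr_fun hc w).symm⟩
  choose c hc using hdiag
  refine ⟨c, fun i w => ?_⟩
  rw [← Subrepresentation.sum_proj h (s (w : V)), Finset.sum_eq_single i]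
  · rw [hc]; rfl
  · intro j _ hji
    have := hirr i
    have := hirr j
    have := hne i j hji.symm
    have h0 : (Subrepresentation.proj h j).comp (s.comp (W i).incl) = 0 := Subsingleton.elim _ _
    have h1 : Subrepresentation.proj h j (s (w : V)) = 0 := DFunLike.congr_fun h0 w
    rw [h1]; rfl
  · simp

theorem Subrepresentation.trace_comp_eq_sum [Fintype ι] [FiniteDimensional ℂ V]
    (h : DirectSum.IsInternal (fun i => (W i).toSubmodule))
    {s : V →ₗ[ℂ] V} {c : ι → ℂ} (hc : ∀ i, ∀ w : (W i).toSubmodule, s w = c i • (w : V)) (g : G) :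
    LinearMap.trace ℂ V (s ∘ₗ ρ g) = ∑ i, c i * (W i).toRepresentation.character g := by
  have hmap : ∀ i, Set.MapsTo (s ∘ₗ ρ g) (W i).toSubmodule (W i).toSubmodule := by
    intro i w hw
    change s (ρ g w) ∈ _
    rw [hc i ⟨_, (W i).apply_mem_toSubmodule g hw⟩]
    exact Submodule.smul_mem _ _ ((W i).apply_mem_toSubmodule g hw)
  rw [LinearMap.trace_eq_sum_trace_restrict h hmap]
  refine Finset.sum_congr rfl fun i _ => ?_
  have : (s ∘ₗ ρ g).restrict (hmap i) = c i • (W i).toRepresentation g := by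
    ext w
    exact hc i ((W i).toRepresentation g w)
  rw [this, map_smul, smul_eq_mul]
  rfl

theorem Subrepresentation.character_eq_sum [Fintype ι] [FiniteDimensional ℂ V]
    (h : DirectSum.IsInternal (fun i => (W i).toSubmodule)) (g : G) :
    ρ.character g = ∑ i, (W i).toRepresentation.character g := by
  have := Subrepresentation.trace_comp_eq_sum h (s := LinearMap.id) (c := fun _ => 1)
    (fun i w => by simp) g
  simpa [Representation.character] using this

/-- Characters of pairwise non-isomorphic irreducible representations are linearly independent. -/
theorem Subrepresentation.coeff_eq_of_sum_character_eq [Finite G] [Fintype ι]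
    [FiniteDimensional ℂ V] (hirr : ∀ i, (W i).toRepresentation.IsIrreducible)
    (hne : ∀ i j, i ≠ j →
      IsEmpty (Representation.Equiv (W i).toRepresentation (W j).toRepresentation))
    {c d : ι → ℂ} (hcd : ∀ g, ∑ i, c i * (W i).toRepresentation.character g =
      ∑ i, d i * (W i).toRepresentation.character g) : c = d := by
  classical
  have := Fintype.ofFinite G
  have : Invertible (Nat.card G : ℂ) := invertibleOfNonzero (by simp)
  have key : ∀ (c : ι → ℂ) (j : ι), c j = (Nat.card G : ℂ)⁻¹ * ∑ g : G,
      (∑ i, c i * (W i).toRepresentation.character g) *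
        (W j).toRepresentation.character g⁻¹ := by
    intro c j
    have h1 : ∀ i, (Nat.card G : ℂ)⁻¹ * ∑ g : G, (W i).toRepresentation.character g *
        (W j).toRepresentation.character g⁻¹ = if i = j then 1 else 0 := by
      intro i
      have := hirr i
      have := hirr j
      rw [Representation.char_orthonormal]
      by_cases hij : i = j
      · subst hij
        rw [if_pos ⟨Representation.Equiv.refl _⟩, if_pos rfl]
      · have := hne j i (Ne.symm hij)
        rw [if_neg (not_nonempty_iff.2 this), if_neg hij]
    simp_rw [Finset.sum_mul]
    rw [Finset.sum_comm, Finset.mul_sum]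
    have h2 : ∀ i, (Nat.card G : ℂ)⁻¹ * ∑ g : G, c i * (W i).toRepresentation.character g *
        (W j).toRepresentation.character g⁻¹ = if i = j then c i else 0 := by
      intro i
      simp_rw [mul_assoc]
      rw [← Finset.mul_sum, mul_left_comm, h1, mul_ite, mul_one, mul_zero]
    simp_rw [h2]
    simp
  funext j
  rw [key c j, key d j]
  simp_rw [hcd]

end InternalSum

/-! ### Conjugation sums and Gelfand's trick -/

section ConjSum

variable {G H A : Type*} [Group G] [Group H] [Ring A]

/-- The sum of the images under `π` of the conjugates of `p` by the elements of the image of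
`δ : G →* H`. -/
def conjSum [Fintype G] (δ : G →* H) (π : H →* A) (p : H) : A := ∑ h : G, π (δ h * p * (δ h)⁻¹)

variable [Fintype G] (δ : G →* H) (π : H →* A)

theorem conjSum_conj (p : H) (g : G) : conjSum δ π (δ g * p * (δ g)⁻¹) = conjSum δ π p := by
  refine Fintype.sum_equiv (Equiv.mulRight g) _ _ fun h => ?_
  simp [mul_assoc]

theorem conjSum_mul (p q : H) :
    conjSum δ π p * conjSum δ π q = ∑ h : G, conjSum δ π (p * (δ h * q * (δ h)⁻¹)) := by
  unfold conjSum
  rw [Finset.sum_comm, Finset.sum_mul_sum]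
  refine Finset.sum_congr rfl fun k _ => ?_
  refine Fintype.sum_equiv (Equiv.mulLeft k⁻¹) _ _ fun l => ?_
  rw [← map_mul]
  simp [mul_assoc]

/-- Gelfand's trick: inverting p · kqk⁻¹ and conjugating by k⁻¹ gives q⁻¹ · k⁻¹p⁻¹k, a term of the
product in the other order. -/
theorem conjSum_mul_comm (h : ∀ p, conjSum δ π p⁻¹ = conjSum δ π p) (p q : H) :
    conjSum δ π p * conjSum δ π q = conjSum δ π q * conjSum δ π p := by
  rw [conjSum_mul, ← h q, ← h p, conjSum_mul]
  refine Fintype.sum_equiv (Equiv.inv G) _ _ fun k => ?_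
  rw [← h, ← conjSum_conj δ π _ k⁻¹]
  simp [mul_assoc]

theorem mul_conjSum (p : H) (g : G) : π (δ g) * conjSum δ π p = conjSum δ π p * π (δ g) := by
  unfold conjSum
  rw [Finset.sum_mul, Finset.mul_sum]
  refine Fintype.sum_equiv (Equiv.mulLeft g) _ _ fun h => ?_
  rw [← map_mul, ← map_mul]
  simp [mul_assoc]

variable [Algebra ℂ A]

theorem mem_span_conjSum {T : A} (hT : ∀ g, π (δ g) * T = T * π (δ g))
    (hspan : T ∈ Submodule.span ℂ (Set.range π)) :
    T ∈ Submodule.span ℂ (Set.range (conjSum δ π)) := by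
  -- Averaging multiplies T by |G| and sends each π p to its conjugation sum.
  let avg : A →ₗ[ℂ] A := ∑ h : G, LinearMap.mulLeftRight ℂ (π (δ h), π (δ h⁻¹))
  have havg : ∀ x, avg x = ∑ h : G, π (δ h) * x * π (δ h⁻¹) := fun x => by
    simp [avg, LinearMap.mulLeftRight_apply]
  have h1 : avg T = (Fintype.card G : ℂ) • T := by
    rw [havg]
    have : ∀ h, π (δ h) * T * π (δ h⁻¹) = T := fun h => by
      rw [hT, mul_assoc, ← map_mul, ← map_mul]
      simp
    simp_rw [this]
    simp [Nat.cast_smul_eq_nsmul]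
  have h2 : Submodule.span ℂ (Set.range π) ≤
      (Submodule.span ℂ (Set.range (conjSum δ π))).comap avg := by
    rw [Submodule.span_le]
    rintro _ ⟨p, rfl⟩
    refine Submodule.subset_span ⟨p, ?_⟩
    rw [havg]
    simp [conjSum, map_mul]
  have h3 : (Fintype.card G : ℂ) • T ∈ Submodule.span ℂ (Set.range (conjSum δ π)) := by
    rw [← h1]
    exact h2 hspan
  exact (Submodule.smul_mem_iff _ (by simp)).1 h3

theorem mul_comm_of_commute_map (h : ∀ p, conjSum δ π p⁻¹ = conjSum δ π p)
    (hspan : Submodule.span ℂ (Set.range π) = ⊤) {S T : A}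
    (hS : ∀ g, π (δ g) * S = S * π (δ g)) (hT : ∀ g, π (δ g) * T = T * π (δ g)) :
    S * T = T * S := by
  have hS' := mem_span_conjSum δ π hS (hspan ▸ Submodule.mem_top)
  have hT' := mem_span_conjSum δ π hT (hspan ▸ Submodule.mem_top)
  clear hS hT hspan
  induction hS', hT' using Submodule.span_induction₂ with
  | mem_mem x y hx hy =>
    obtain ⟨p, rfl⟩ := hx
    obtain ⟨q, rfl⟩ := hy
    exact conjSum_mul_comm δ π h p q
  | zero_left => simp
  | zero_right => simp
  | add_left x y z _ _ _ h1 h2 => rw [add_mul, mul_add, h1, h2]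
  | add_right x y z _ _ _ h1 h2 => rw [add_mul, mul_add, h1, h2]
  | smul_left r x y _ _ h1 => rw [smul_mul_assoc, mul_smul_comm, h1]
  | smul_right r x y _ _ h1 => rw [smul_mul_assoc, mul_smul_comm, h1]

end ConjSum

/-! ### External tensor products and commutative commutants -/

section ExternalTensor

variable {G U V : Type*} [Group G] [AddCommGroup U] [Module ℂ U] [AddCommGroup V] [Module ℂ V]

/-- The external tensor product of two representations of `G`, a representation of `G × G`. -/
noncomputable def Representation.extTprod (ρ : Representation ℂ G U) (σ : Representation ℂ G V) :
    Representation ℂ (G × G) (U ⊗[ℂ] V) where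
  toFun p := TensorProduct.map (ρ p.1) (σ p.2)
  map_one' := by
    change TensorProduct.map (ρ 1) (σ 1) = 1
    rw [map_one, map_one, TensorProduct.map_one]
  map_mul' p q := by
    change TensorProduct.map (ρ (p.1 * q.1)) (σ (p.2 * q.2)) = _
    rw [map_mul, map_mul, TensorProduct.map_mul]

theorem Representation.span_range_extTprod_eq_top [Finite G] {ρ : Representation ℂ G U}
    {σ : Representation ℂ G V} (hρ : ρ.IsIrreducible) (hσ : σ.IsIrreducible) :
    Submodule.span ℂ (Set.range (ρ.extTprod σ)) = ⊤ := by
  have := hρ.finiteDimensional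
  have := hσ.finiteDimensional
  rw [eq_top_iff]
  rintro T -
  obtain ⟨t, rfl⟩ := (homTensorHomEquiv ℂ U V U V).surjective T
  induction t with
  | zero => simp
  | add x y hx hy =>
    rw [map_add]
    exact Submodule.add_mem _ hx hy
  | tmul f g =>
    rw [homTensorHomEquiv_apply, TensorProduct.homTensorHomMap_apply]
    have hf : f ∈ Submodule.span ℂ (Set.range ρ) := hρ.span_range_eq_top ▸ Submodule.mem_top
    have hg : g ∈ Submodule.span ℂ (Set.range σ) := hσ.span_range_eq_top ▸ Submodule.mem_top
    induction hf, hg using Submodule.span_induction₂ with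
    | mem_mem x y hx hy =>
      obtain ⟨a, rfl⟩ := hx
      obtain ⟨b, rfl⟩ := hy
      exact Submodule.subset_span ⟨(a, b), rfl⟩
    | zero_left => simp
    | zero_right => simp
    | add_left x y z _ _ _ h1 h2 =>
      rw [TensorProduct.map_add_left]; exact Submodule.add_mem _ h1 h2
    | add_right x y z _ _ _ h1 h2 =>
      rw [TensorProduct.map_add_right]; exact Submodule.add_mem _ h1 h2
    | smul_left r x y _ _ h1 =>
      rw [TensorProduct.map_smul_left]; exact Submodule.smul_mem _ _ h1
    | smul_right r x y _ _ h1 =>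
      rw [TensorProduct.map_smul_right]; exact Submodule.smul_mem _ _ h1

theorem isMultiplicityFree_of_commute [Finite G] [FiniteDimensional ℂ V]
    (ρ : Representation ℂ G V)
    (h : ∀ S T : Module.End ℂ V, (∀ g, ρ g * S = S * ρ g) → (∀ g, ρ g * T = T * ρ g) →
      S * T = T * S) : DoublyReal.IsMultiplicityFree ρ := by
  obtain ⟨n, W, hint, hirr⟩ := ρ.exists_isInternal_irreducible
  refine ⟨n, W, hint, hirr, fun i j hij => ⟨fun φ => ?_⟩⟩
  have hcomm : ∀ f : Representation.IntertwiningMap ρ ρ, ∀ g, ρ g * f.toLinearMap =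
      f.toLinearMap * ρ g := fun f g => (f.isIntertwining' g).symm
  -- An isomorphism of two summands gives a nonzero p from the i-th to the j-th. With q the i-th
  -- projection, pq = p but qp = 0.
  let p := (W j).incl.comp (φ.toIntertwiningMap.comp (Subrepresentation.proj hint i))
  let q := (W i).incl.comp (Subrepresentation.proj hint i)
  have hpq := h _ _ (hcomm p) (hcomm q)
  obtain ⟨w, hw⟩ : ∃ w : (W i).toSubmodule, w ≠ 0 := by
    by_contra! hall
    refine (hirr i).toNontrivial.exists_pair_ne.elim fun S ⟨T, hST⟩ => hST ?_
    have : Subsingleton (W i).toSubmodule := ⟨fun a b => by rw [hall a, hall b]⟩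
    exact Subrepresentation.toSubmodule_injective (Subsingleton.elim _ _)
  have h1 := LinearMap.congr_fun hpq (w : V)
  have hq : q (w : V) = w := congrArg Subtype.val (Subrepresentation.proj_coe hint i w)
  have hp : p (w : V) = φ w :=
    congrArg (fun w => (φ w : V)) (Subrepresentation.proj_coe hint i w)
  have hqp : q (φ w : V) = 0 :=
    congrArg Subtype.val (Subrepresentation.proj_coe_of_ne hint hij.symm (φ w))
  have h2 : p (q (w : V)) = q (p (w : V)) := h1
  rw [hq, hp, hqp] at h2
  have h3 : φ w = 0 := Subtype.ext h2
  exact hw (φ.toLinearEquiv.map_eq_zero_iff.1 h3)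

end ExternalTensor

/-! ### The regular character -/

section RegularRepresentation

variable {G : Type*} [Group G]

/-- The right regular representation of `G`, on functions on a set of labels for `G`. -/
noncomputable def Representation.relabelledRegular {n : ℕ} (e : G ≃ Fin n) :
    Representation ℂ G (Fin n → ℂ) where
  toFun g := LinearMap.funLeft ℂ ℂ fun i => e (e.symm i * g)
  map_one' := by
    ext
    simp [LinearMap.funLeft_apply]
  map_mul' g h := by
    ext
    simp [LinearMap.funLeft_apply, mul_assoc]

open scoped Classical in
theorem Representation.character_relabelledRegular {n : ℕ} (e : G ≃ Fin n) (g : G) :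
    (Representation.relabelledRegular e).character g = ((if g = 1 then n else 0 : ℕ) : ℂ) := by
  rw [Representation.character, LinearMap.trace_eq_matrix_trace ℂ (Pi.basisFun ℂ (Fin n)),
    Matrix.trace]
  have : ∀ i, (LinearMap.toMatrix (Pi.basisFun ℂ (Fin n)) (Pi.basisFun ℂ (Fin n))
      (Representation.relabelledRegular e g)).diag i = if g = 1 then 1 else 0 := by
    intro i
    rw [Matrix.diag_apply, LinearMap.toMatrix_apply]
    change (Pi.basisFun ℂ (Fin n)) i (e (e.symm i * g)) = _
    rw [Pi.basisFun_apply, Pi.single_apply]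
    refine if_congr ?_ rfl rfl
    rw [← e.eq_symm_apply, mul_eq_left]
  simp_rw [this]
  split_ifs <;> simp

end RegularRepresentation

/-! ### The two implications -/

namespace DoublyReal

variable {G U V : Type*} [Group G] [AddCommGroup U] [Module ℂ U] [AddCommGroup V] [Module ℂ V]

theorem isDoublyReal_iff :
    IsDoublyReal G ↔ ∀ x y : G, ∃ g : G, x⁻¹ = g * x * g⁻¹ ∧ y⁻¹ = g * y * g⁻¹ := by
  constructor
  · intro h x y
    obtain ⟨g, hg⟩ := h ![x, y] ![x, y] ⟨1, fun i => by simp⟩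
    exact ⟨g, hg 0, hg 1⟩
  · rintro h x y ⟨k, hk⟩
    obtain ⟨g, h0, h1⟩ := h (x 0) (x 1)
    refine ⟨k * g, fun i => ?_⟩
    have hi : (x i)⁻¹ = g * x i * g⁻¹ := by
      fin_cases i
      · exact h0
      · exact h1
    calc (y i)⁻¹ = k * (x i)⁻¹ * k⁻¹ := by rw [hk]; group
      _ = _ := by rw [hi]; group

theorem IsDoublyReal.isReal (h : IsDoublyReal G) : IsReal G := fun x => by
  obtain ⟨g, hg, -⟩ := isDoublyReal_iff.1 h x x
  exact isConj_iff.2 ⟨g, hg.symm⟩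

variable (G) in
/-- The diagonal embedding of `G` in `G × G`. -/
abbrev diag : G →* G × G := (MonoidHom.id G).prod (MonoidHom.id G)

theorem IsDoublyReal.isMultiplicityFree_tprod [Finite G] (h : IsDoublyReal G)
    {ρ : Representation ℂ G U} {σ : Representation ℂ G V} (hρ : ρ.IsIrreducible)
    (hσ : σ.IsIrreducible) : IsMultiplicityFree (ρ.tprod σ) := by
  have := Fintype.ofFinite G
  have := hρ.finiteDimensional
  have := hσ.finiteDimensional
  refine isMultiplicityFree_of_commute _ fun S T hS hT =>
    mul_comm_of_commute_map (diag G) (ρ.extTprod σ) (fun p => ?_)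
      (Representation.span_range_extTprod_eq_top hρ hσ) hS hT
  obtain ⟨g, hx, hy⟩ := isDoublyReal_iff.1 h p.1 p.2
  have : p⁻¹ = diag G g * p * (diag G g)⁻¹ := Prod.ext hx hy
  rw [this, conjSum_conj]

theorem IsReal.character_inv (h : IsReal G) (ρ : Representation ℂ G V) (g : G) :
    ρ.character g⁻¹ = ρ.character g := by
  obtain ⟨c, hc⟩ := isConj_iff.1 (h g)
  rw [← hc, Representation.char_conj]

theorem IsReal.prod {H : Type*} [Group H] (hG : IsReal G) (hH : IsReal H) : IsReal (G × H) := by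
  intro p
  obtain ⟨a, ha⟩ := isConj_iff.1 (hG p.1)
  obtain ⟨b, hb⟩ := isConj_iff.1 (hH p.2)
  exact isConj_iff.2 ⟨(a, b), Prod.ext ha hb⟩

theorem trace_conjSum_mul {H : Type*} [Group H] [Fintype G] (δ : G →* H)
    (π : Representation ℂ H V) (p q : H) :
    LinearMap.trace ℂ V (conjSum δ π p * π q) =
      ∑ h : G, π.character (δ h * p * (δ h)⁻¹ * q) := by
  rw [conjSum, Finset.sum_mul, map_sum]
  simp_rw [← map_mul]
  rfl

/-- Characters of a real group ignore inversion, and hp⁻¹h⁻¹q has inverse q⁻¹ · hph⁻¹, a cyclic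
shift of hph⁻¹q⁻¹. -/
theorem IsReal.trace_conjSum_inv_mul {H : Type*} [Group H] [Fintype G] (hH : IsReal H) (δ : G →* H)
    (π : Representation ℂ H V) (p q : H) :
    LinearMap.trace ℂ V (conjSum δ π p⁻¹ * π q) =
      LinearMap.trace ℂ V (conjSum δ π p * π q⁻¹) := by
  rw [trace_conjSum_mul, trace_conjSum_mul]
  refine Finset.sum_congr rfl fun h _ => ?_
  rw [← hH.character_inv, Representation.char_mul_comm]
  simp [mul_assoc]

theorem conjSum_inv_eq_of_isMultiplicityFree [Fintype G] [FiniteDimensional ℂ V] {H : Type*}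
    [Group H] (hG : IsReal G) (hH : IsReal H) (δ : G →* H) (π : Representation ℂ H V)
    {ρ : Representation ℂ G V} (hρ : ∀ g, ρ g = π (δ g)) (hmf : IsMultiplicityFree ρ) (p : H) :
    conjSum δ π p⁻¹ = conjSum δ π p := by
  obtain ⟨n, W, hint, hirr, hne⟩ := hmf
  have hschur : ∀ p, ∃ c : Fin n → ℂ, ∀ i, ∀ w : (W i).toSubmodule,
      conjSum δ π p w = c i • (w : V) := fun p =>
    Subrepresentation.exists_forall_apply_eq_smul hint hirr hne
      ⟨conjSum δ π p, fun g => by rw [hρ]; exact (mul_conjSum δ π p g).symm⟩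
  obtain ⟨c, hc⟩ := hschur p
  obtain ⟨d, hd⟩ := hschur p⁻¹
  have hcd : d = c := by
    refine Subrepresentation.coeff_eq_of_sum_character_eq hirr hne fun g => ?_
    rw [← Subrepresentation.trace_comp_eq_sum hint hd, hρ]
    refine (hH.trace_conjSum_inv_mul δ π p (δ g)).trans ?_
    rw [← map_inv, ← hρ]
    refine (Subrepresentation.trace_comp_eq_sum hint hc g⁻¹).trans ?_
    simp_rw [hG.character_inv]
  refine LinearMap.ext fun v => ?_
  rw [← Subrepresentation.sum_proj hint v, map_sum, map_sum]
  refine Finset.sum_congr rfl fun i _ => ?_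
  rw [hc, hd, hcd]

theorem character_extTprod [FiniteDimensional ℂ U] [FiniteDimensional ℂ V]
    (ρ : Representation ℂ G U) (σ : Representation ℂ G V) (p : G × G) :
    (ρ.extTprod σ).character p = ρ.character p.1 * σ.character p.2 :=
  LinearMap.trace_tensorProduct' (ρ p.1) (σ p.2)

theorem sum_character_conj_inv_eq [Fintype G] [FiniteDimensional ℂ U] [FiniteDimensional ℂ V]
    (hG : IsReal G) {ρ : Representation ℂ G U} {σ : Representation ℂ G V}
    (hmf : IsMultiplicityFree (ρ.tprod σ)) (x y a b : G) :
    ∑ h : G, ρ.character (h * x⁻¹ * h⁻¹ * a) * σ.character (h * y⁻¹ * h⁻¹ * b) =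
      ∑ h : G, ρ.character (h * x * h⁻¹ * a) * σ.character (h * y * h⁻¹ * b) := by
  have h := congrArg (fun T => LinearMap.trace ℂ _ (T * ρ.extTprod σ (a, b)))
    (conjSum_inv_eq_of_isMultiplicityFree hG (hG.prod hG) (diag G) (ρ.extTprod σ)
      (fun g => rfl) hmf (x, y))
  simp only [trace_conjSum_mul, character_extTprod] at h
  exact h

theorem isDoublyReal_of_isReal [Finite G] (hG : IsReal G)
    (hmf : HasMultiplicityFreeTensorProducts G) : IsDoublyReal G := by
  classical
  have := Fintype.ofFinite G
  rw [isDoublyReal_iff]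
  intro x y
  let e := Fintype.equivFin G
  -- Labelling G by `Fin n` puts the space in `Type`, as `hmf` requires, whatever the universe of G.
  let R := Representation.relabelledRegular e
  obtain ⟨m, W, hint, hirr⟩ := R.exists_isInternal_irreducible
  let F (x y a b : G) : ℂ :=
    ∑ h : G, R.character (h * x * h⁻¹ * a) * R.character (h * y * h⁻¹ * b)
  have hF : ∀ x y a b, F x y a b = ∑ k, ∑ l, ∑ h : G,
      (W k).toRepresentation.character (h * x * h⁻¹ * a) *
        (W l).toRepresentation.character (h * y * h⁻¹ * b) := by
    intro x y a b
    simp_rw [F, Subrepresentation.character_eq_sum hint, Finset.sum_mul_sum]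
    rw [Finset.sum_comm]
    exact Finset.sum_congr rfl fun k _ => Finset.sum_comm
  have hinv : F x⁻¹ y⁻¹ x y = F x y x y := by
    rw [hF, hF]
    exact Finset.sum_congr rfl fun k _ => Finset.sum_congr rfl fun l _ =>
      sum_character_conj_inv_eq hG (hmf _ _ _ _ (hirr k) (hirr l)) x y x y
  by_contra! hno
  have hzero : F x y x y = 0 := by
    refine Finset.sum_eq_zero fun h _ => ?_
    simp only [R, Representation.character_relabelledRegular]
    by_cases h1 : h * x * h⁻¹ * x = 1
    · have h2 : ¬ h * y * h⁻¹ * y = 1 := fun h2 =>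
        hno h (eq_inv_of_mul_eq_one_left h1).symm (eq_inv_of_mul_eq_one_left h2).symm
      simp [h2]
    · simp [h1]
  rw [hzero] at hinv
  simp only [F, R, Representation.character_relabelledRegular] at hinv
  norm_cast at hinv
  -- The terms are natural numbers, and h = 1 contributes |G|² ≠ 0.
  have h1 := Finset.sum_eq_zero_iff.1 hinv 1 (Finset.mem_univ _)
  simp at h1

end DoublyReal

theorem mainTheorem6 (G : Type*) [Group G] [Finite G] :
    DoublyReal.IsDoublyReal G ↔
      DoublyReal.IsReal G ∧ DoublyReal.HasMultiplicityFreeTensorProducts G := by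
  refine ⟨fun h => ⟨h.isReal, fun U V _ _ _ _ ρ σ hρ hσ => h.isMultiplicityFree_tprod hρ hσ⟩,
    fun h => DoublyReal.isDoublyReal_of_isReal h.1 h.2⟩
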